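/- Let $J\subset\mathbb{R}^2$ be a Jordan curve. For $p\in\mathbb{R}^2\setminus J$ let $s_p$ be the maximal open vertical segment (possibly of infinite length) through $p$ that does not meet $J$. Call $s_p$ and $s_q$ equivalent if they can be joined by a finite chain of such open segments in which any two consecutive ones are joined by a horizontal segment disjoint from $J$; write $[s_p]$ for the equivalence class. Let $p^*\in\mathbb{R}^2\setminus J$ be such that $[s_{p^*}]$ contains no open segment of infinite length. For a horizontal segment $t$ whose interior does not meet $J$, the horizontal sweep $H(t)$ is the set of all $s_p$ with $p\in t\setminus J$; the union of these segments is the region swept by $H(t)$. If $K$ is the boundary of such a region, or of a finite union of such regions, let $\mathcal{V}(K)$ be the set of vertical segments of positive length whose interior lies in $K\setminus J$ and whose two endpoints lie on $J$. The greedy sweepline algorithm $\mathcal{S}_{greedy}$ runs as follows. Let $t_1$ be a horizontal segment with both endpoints on $J$, with interior disjoint from $J$ and with $p^*$ in its interior. For $i=1,2,\dots$, let $E_i$ be the union of the regions swept by $H(t_1),\dots,H(t_i)$, let $K_i$ be the boundary of $E_i$, and let $\mathrm{ext}(K_i)=\mathbb{R}^2\setminus \overline{E_i}$. If $\mathcal{V}(K_i)=\emptyset$,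 halt. Otherwise let $u_i\in\mathcal{V}(K_i)$ be of maximum length (ties broken arbitrarily), let $m_i$ be its midpoint, and let $t_{i+1}$ be a horizontal segment with one endpoint $m_i$ and the other endpoint on $J$, with interior disjoint from $J$ and with $t_{i+1}\setminus\{m_i\}\subset\mathrm{ext}(K_i)$. The recursion tree $T(\mathcal{S}_{greedy})$ has the sweeps $H(t_1),H(t_2),\dots$ of the run as nodes and $H(t_1)$ as root; $H(t_{i+1})$ is a child of the sweep $H(t_j)$, $j\le i$, with $u_i\in\mathcal{V}(\partial H(t_j))$, where $\partial H(t_j)$ is the boundary of the region swept by $H(t_j)$. An infinite ray starting at the root is an infinite sequence $r=(H(t_{i_1}),H(t_{i_2}),\dots)$ with $i_1=1$ in which each term after the first is a child of the preceding one. A limiting segment of $r$ is a (possibly degenerate) vertical segment that is the limit, in the sense of convergence of both endpoints, of open segments $s_k\in H(t_{i_{n_k}})$ for some $n_1<n_2<\cdots$. The ray $r$ is non-terminating if it has a limiting segment of positive length. Then, for every run of $\mathcal{S}_{greedy}$, the recursion tree $T(\mathcal{S}_{greedy})$ has no non-terminating infinite ray starting at the root. -/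

import Mathlib

open Set Filter Topology

namespace Sweep

/-- A Jordan curve in the plane: the image of the circle under a continuous injective map. -/
def IsJordanCurve (J : Set (ℝ × ℝ)) : Prop :=
  ∃ γ : Circle → ℝ × ℝ, Continuous γ ∧ Function.Injective γ ∧ range γ = J

/-- The open segment `s_p`: for `p ∉ J`, the maximal open vertical segment (possibly infinite)
through `p` that does not meet `J`. -/
def openSeg (J : Set (ℝ × ℝ)) (p : ℝ × ℝ) : Set (ℝ × ℝ) :=
  {q | q.1 = p.1 ∧ Disjoint (segment ℝ p q) J}

/-- Two open segments are directly linked if some horizontal segment (possibly a point) that avoids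
`J` joins a point of the one to a point of the other. -/
def Linked (J : Set (ℝ × ℝ)) (s s' : Set (ℝ × ℝ)) : Prop :=
  ∃ p q : ℝ × ℝ, p.2 = q.2 ∧ Disjoint (segment ℝ p q) J ∧ s = openSeg J p ∧ s' = openSeg J q

/-- The equivalence class `[s_p]` of open segments. -/
def segClass (J : Set (ℝ × ℝ)) (p : ℝ × ℝ) : Set (Set (ℝ × ℝ)) :=
  {s | Relation.EqvGen (Linked J) (openSeg J p) s}

/-- A nondegenerate horizontal segment, given by its two endpoints. -/
structure HSeg where
  src : ℝ × ℝ
  tgt : ℝ × ℝ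
  horizontal : src.2 = tgt.2
  nondegenerate : src ≠ tgt

namespace HSeg

/-- The closed segment as a set of points. -/
def carrier (t : HSeg) : Set (ℝ × ℝ) := segment ℝ t.src t.tgt

/-- The segment without its endpoints. -/
def interior (t : HSeg) : Set (ℝ × ℝ) := openSegment ℝ t.src t.tgt

end HSeg

/-- A vertical segment of finite length, possibly degenerate (a point). -/
structure VSeg where
  x : ℝ
  lo : ℝ
  hi : ℝ
  lo_le_hi : lo ≤ hi

namespace VSeg

/-- The segment without its endpoints. -/
def interior (s : VSeg) : Set (ℝ × ℝ) := {s.x} ×ˢ Ioo s.lo s.hi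

def length (s : VSeg) : ℝ := s.hi - s.lo

noncomputable def midpoint (s : VSeg) : ℝ × ℝ := (s.x, (s.lo + s.hi) / 2)

end VSeg

/-- The horizontal sweep `H(t)`: the set of all open segments through points of `t` off `J`. -/
def sweep (J : Set (ℝ × ℝ)) (t : HSeg) : Set (Set (ℝ × ℝ)) :=
  {s | ∃ p ∈ t.carrier, p ∉ J ∧ s = openSeg J p}

/-- The region swept by `H(t)`. -/
def sweepRegion (J : Set (ℝ × ℝ)) (t : HSeg) : Set (ℝ × ℝ) := ⋃₀ sweep J t

/-- `𝒱(K)`: the vertical segments of positive length that lie on the curve `K`, with both endpoints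
on `J` and with no other point on `J`. -/
def verticals (J K : Set (ℝ × ℝ)) : Set VSeg :=
  {s | s.lo < s.hi ∧ s.interior ⊆ K ∧ Disjoint s.interior J ∧ (s.x, s.lo) ∈ J ∧ (s.x, s.hi) ∈ J}

/-- The region swept by `H(t 0), …, H(t i)`. -/
def swept (J : Set (ℝ × ℝ)) (t : ℕ → HSeg) (i : ℕ) : Set (ℝ × ℝ) :=
  ⋃ j ≤ i, sweepRegion J (t j)

/-- The curve `K_i` that bounds the region swept by `H(t 0), …, H(t i)`. -/
def sweptBoundary (J : Set (ℝ × ℝ)) (t : ℕ → HSeg) (i : ℕ) : Set (ℝ × ℝ) :=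
  frontier (swept J t i)

/-- `ext(K_i)`: everything outside the closed region that `K_i` bounds. -/
def sweptExterior (J : Set (ℝ × ℝ)) (t : ℕ → HSeg) (i : ℕ) : Set (ℝ × ℝ) :=
  (closure (swept J t i))ᶜ

/-- A complete run of the greedy sweepline algorithm on `J` from the point `pstar`. Indices start
at `0`. The number `steps` of extensions is infinite if the algorithm does not halt; the horizontal
segments constructed are the `t i` with `i ≤ steps`, and `u i`, for `i < steps`, is the vertical
segment chosen for the extension by `t (i + 1)`. Other values of `t` and `u` are irrelevant. -/
structure GreedyRun (J : Set (ℝ × ℝ)) (pstar : ℝ × ℝ) where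
  steps : ℕ∞
  t : ℕ → HSeg
  u : ℕ → VSeg
  pstar_mem : pstar ∈ (t 0).interior
  first_interior : Disjoint (t 0).interior J
  first_src : (t 0).src ∈ J
  first_tgt : (t 0).tgt ∈ J
  halt : ∀ n : ℕ, steps = n → verticals J (sweptBoundary J t n) = ∅
  choice : ∀ i : ℕ, (i : ℕ∞) < steps → u i ∈ verticals J (sweptBoundary J t i)
  greedy : ∀ i : ℕ, (i : ℕ∞) < steps →
    ∀ v ∈ verticals J (sweptBoundary J t i), v.length ≤ (u i).length
  next_src : ∀ i : ℕ, (i : ℕ∞) < steps → (t (i + 1)).src = (u i).midpoint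
  next_tgt : ∀ i : ℕ, (i : ℕ∞) < steps → (t (i + 1)).tgt ∈ J
  next_interior : ∀ i : ℕ, (i : ℕ∞) < steps → Disjoint (t (i + 1)).interior J
  next_exterior : ∀ i : ℕ, (i : ℕ∞) < steps →
    (t (i + 1)).carrier \ {(u i).midpoint} ⊆ sweptExterior J t i

namespace GreedyRun

variable {J : Set (ℝ × ℝ)} {pstar : ℝ × ℝ}

/-- The nodes of the recursion tree; node `i` is the horizontal sweep `H(t i)`. -/
def Node (R : GreedyRun J pstar) : Type := {i : ℕ // (i : ℕ∞) ≤ R.steps}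

/-- The root of the recursion tree is the initial horizontal sweep. -/
def root (R : GreedyRun J pstar) : R.Node := ⟨0, by simp⟩

/-- The edges of the recursion tree, directed from parent to child: the sweep `H(t (i + 1))` is a
child of the earlier sweep `H(t a)` whose boundary contains the chosen vertical segment `u i`. -/
def IsChild (R : GreedyRun J pstar) (a b : R.Node) : Prop :=
  ∃ i : ℕ, b.1 = i + 1 ∧ a.1 ≤ i ∧ R.u i ∈ verticals J (frontier (sweepRegion J (R.t a.1)))

/-- An infinite ray of the recursion tree that starts at the root. -/
def IsRootRay (R : GreedyRun J pstar) (r : ℕ → R.Node) : Prop :=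
  r 0 = R.root ∧ ∀ k, R.IsChild (r k) (r (k + 1))

/-- `s` is a limiting segment of `r`: a limit of open segments taken from the sweeps
`H(t (r (φ 0))), H(t (r (φ 1))), …` along a subsequence of the ray. -/
def IsLimitingSegment (R : GreedyRun J pstar) (r : ℕ → R.Node) (s : VSeg) : Prop :=
  ∃ φ : ℕ → ℕ, StrictMono φ ∧ ∃ σ : ℕ → VSeg,
    (∀ k, (σ k).interior ∈ sweep J (R.t (r (φ k)).1)) ∧
    Tendsto (fun k => (σ k).x) atTop (𝓝 s.x) ∧
    Tendsto (fun k => (σ k).lo) atTop (𝓝 s.lo) ∧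
    Tendsto (fun k => (σ k).hi) atTop (𝓝 s.hi)

/-- A ray is non-terminating if it has a limiting segment of positive length. -/
def NonTerminating (R : GreedyRun J pstar) (r : ℕ → R.Node) : Prop :=
  ∃ s : VSeg, R.IsLimitingSegment r s ∧ 0 < s.length

end GreedyRun

end Sweep

/-!
Each vertical segment `v n` chosen along a ray is a cross-cut of `J`, and it separates the sweeps up
to the `n`-th one from the later ones: a rectilinear path off `J` that joins the two sides of the
cross-cut without meeting it would close up to a loop off `J` whose crossing number with the upward
vertical ray from a point is locally constant on `J`, but differs by one between the two endpoints
of the cross-cut.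

If open segments of infinitely many sweeps converge to a segment of positive length, then a
subsequence converges from one side. By local connectedness of the curve, a one-sided neighbourhood
of an interior point of the limit is free of `J`, so by separation all later cross-cuts pass through
it and, along a further subsequence, converge to a segment of positive length themselves. Two of
them, close enough to their limit, contradict each other: the horizontal segment that leaves the
earlier one from its midpoint can end on `J` only beyond the later one, which it must not cross, and
if it leaves in the other direction, then the earlier one fails to separate the sweep before it from
the later one.
-/

namespace Sweep

variable {J F G : Set (ℝ × ℝ)} {p q r z w : ℝ × ℝ}

/-! ### Horizontal and vertical segments -/

theorem mem_uIoo_iff {α : Type*} [LinearOrder α] {a b c : α} :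
    c ∈ uIoo a b ↔ a < c ∧ c < b ∨ b < c ∧ c < a := by
  simp only [uIoo_eq_union, mem_union, mem_Ioo]

theorem mem_segment_iff_of_snd_eq (h : p.2 = q.2) :
    z ∈ segment ℝ p q ↔ z.1 ∈ uIcc p.1 q.1 ∧ z.2 = p.2 := by
  obtain ⟨a, b⟩ := p
  obtain ⟨c, d⟩ := q
  obtain rfl : b = d := h
  rw [← Prod.image_mk_segment_left, segment_eq_uIcc]
  simp only [mem_image, Prod.ext_iff]
  grind

theorem mem_segment_iff_of_fst_eq (h : p.1 = q.1) :
    z ∈ segment ℝ p q ↔ z.1 = p.1 ∧ z.2 ∈ uIcc p.2 q.2 := by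
  obtain ⟨a, b⟩ := p
  obtain ⟨c, d⟩ := q
  obtain rfl : a = c := h
  rw [← Prod.image_mk_segment_right, segment_eq_uIcc]
  simp only [mem_image, Prod.ext_iff]
  grind

theorem tendsto_mk_fst (p : ℝ × ℝ) : Tendsto (fun z : ℝ × ℝ => (z.1, p.2)) (𝓝 p) (𝓝 p) :=
  (continuous_fst.prodMk continuous_const).tendsto p

theorem VSeg.mem_interior_iff {v : VSeg} :
    z ∈ v.interior ↔ z.1 = v.x ∧ v.lo < z.2 ∧ z.2 < v.hi := by
  simp only [VSeg.interior, mem_prod, mem_singleton_iff, mem_Ioo]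

namespace HSeg

variable {t : HSeg}

theorem src_fst_ne_tgt_fst (t : HSeg) : t.src.1 ≠ t.tgt.1 :=
  fun h => t.nondegenerate (Prod.ext h t.horizontal)

theorem mem_carrier_iff : z ∈ t.carrier ↔ z.1 ∈ uIcc t.src.1 t.tgt.1 ∧ z.2 = t.src.2 :=
  mem_segment_iff_of_snd_eq t.horizontal

theorem mem_interior_iff : z ∈ t.interior ↔ z.1 ∈ uIoo t.src.1 t.tgt.1 ∧ z.2 = t.src.2 := by
  have hsegment : openSegment ℝ t.src t.tgt =
      (fun x => (x, t.src.2)) '' uIoo t.src.1 t.tgt.1 := by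
    rw [← Ioo_min_max, ← openSegment_eq_Ioo' t.src_fst_ne_tgt_fst, Prod.image_mk_openSegment_left]
    congr 1
    exact Prod.ext rfl t.horizontal.symm
  rw [HSeg.interior, hsegment]
  simp only [mem_image, Prod.ext_iff]
  grind

theorem interior_subset_carrier : t.interior ⊆ t.carrier :=
  openSegment_subset_segment ..

theorem src_mem_carrier : t.src ∈ t.carrier :=
  left_mem_segment ..

theorem src_notMem_interior : t.src ∉ t.interior :=
  fun h => left_notMem_uIoo (mem_interior_iff.1 h).1

theorem eq_src_or_eq_tgt_or_mem_interior (hz : z ∈ t.carrier) :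
    z = t.src ∨ z = t.tgt ∨ z ∈ t.interior := by
  rwa [carrier, ← insert_endpoints_openSegment] at hz

theorem disjoint_segment (ht : Disjoint t.interior F) (hp : p ∈ t.carrier) (hq : q ∈ t.carrier)
    (hpF : p ∉ F) (hqF : q ∉ F) : Disjoint (segment ℝ p q) F := by
  rw [mem_carrier_iff] at hp hq
  refine disjoint_left.2 fun z hz hzF => ?_
  rw [mem_segment_iff_of_snd_eq (hp.2.trans hq.2.symm)] at hz
  have hzp : z.1 ≠ p.1 := fun h => hpF ((Prod.ext h hz.2 : z = p) ▸ hzF)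
  have hzq : z.1 ≠ q.1 := fun h =>
    hqF ((Prod.ext h (hz.2.trans (hp.2.trans hq.2.symm)) : z = q) ▸ hzF)
  refine disjoint_left.1 ht (mem_interior_iff.2 ⟨?_, hz.2.trans hp.2⟩) hzF
  rw [mem_uIcc] at *
  rw [mem_uIoo_iff]
  grind

end HSeg

theorem mem_openSeg_self (hp : p ∉ J) : p ∈ openSeg J p :=
  ⟨rfl, by rwa [segment_same, disjoint_singleton_left]⟩

theorem mem_openSeg_comm : q ∈ openSeg J p ↔ p ∈ openSeg J q :=
  and_congr eq_comm (by rw [segment_symm])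

theorem disjoint_openSeg : Disjoint (openSeg J p) J :=
  disjoint_left.2 fun _ hz => disjoint_left.1 hz.2 (right_mem_segment ..)

theorem segment_subset_openSeg (hq : q ∈ openSeg J p) : segment ℝ p q ⊆ openSeg J p := by
  intro z hz
  refine ⟨((mem_segment_iff_of_fst_eq hq.1.symm).1 hz).1, hq.2.mono_left ?_⟩
  exact (convex_segment p q).segment_subset (left_mem_segment ..) hz

theorem openSeg_subset_of_mem (hq : q ∈ openSeg J p) : openSeg J q ⊆ openSeg J p := by
  intro z hz
  refine ⟨hz.1.trans hq.1, disjoint_left.2 fun w hw hwJ => ?_⟩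
  rw [mem_segment_iff_of_fst_eq (hz.1.trans hq.1).symm] at hw
  rcases uIcc_subset_uIcc_union_uIcc (b := q.2) hw.2 with h | h
  · exact disjoint_left.1 hq.2 ((mem_segment_iff_of_fst_eq hq.1.symm).2 ⟨hw.1, h⟩) hwJ
  · exact disjoint_left.1 hz.2
      ((mem_segment_iff_of_fst_eq hz.1.symm).2 ⟨hw.1.trans hq.1.symm, h⟩) hwJ

theorem openSeg_eq_of_mem (hq : q ∈ openSeg J p) : openSeg J q = openSeg J p :=
  (openSeg_subset_of_mem hq).antisymm (openSeg_subset_of_mem (mem_openSeg_comm.1 hq))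

theorem mem_sweepRegion_iff {t : HSeg} :
    z ∈ sweepRegion J t ↔ ∃ p ∈ t.carrier, p ∉ J ∧ z ∈ openSeg J p := by
  simp only [sweepRegion, sweep, mem_sUnion, mem_ofPred_eq]
  grind

theorem openSeg_mem_sweep {t : HSeg} (hz : z ∈ sweepRegion J t) : openSeg J z ∈ sweep J t := by
  obtain ⟨p, hp, hpJ, hzp⟩ := mem_sweepRegion_iff.1 hz
  exact ⟨p, hp, hpJ, openSeg_eq_of_mem hzp⟩

theorem mem_sweepRegion_of_mem_carrier {t : HSeg} (hz : z ∈ t.carrier) (hzJ : z ∉ J) :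
    z ∈ sweepRegion J t :=
  mem_sweepRegion_iff.2 ⟨z, hz, hzJ, mem_openSeg_self hzJ⟩

/-! ### Cross-cuts -/

/-- A cross-cut of `J`: a nondegenerate vertical segment that meets `J` exactly in its two
endpoints. -/
structure IsCrosscut (J : Set (ℝ × ℝ)) (v : VSeg) : Prop where
  lt : v.lo < v.hi
  disjoint : Disjoint v.interior J
  lo_mem : (v.x, v.lo) ∈ J
  hi_mem : (v.x, v.hi) ∈ J

namespace IsCrosscut

variable {v v' : VSeg}

theorem midpoint_mem (hv : IsCrosscut J v) : v.midpoint ∈ v.interior := by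
  have := hv.lt
  refine VSeg.mem_interior_iff.2 ⟨rfl, ?_, ?_⟩ <;> simp only [VSeg.midpoint] <;> linarith

theorem openSeg_eq (hv : IsCrosscut J v) (hp : p ∈ v.interior) : openSeg J p = v.interior := by
  rw [VSeg.mem_interior_iff] at hp
  ext z
  rw [VSeg.mem_interior_iff]
  constructor
  · rintro ⟨hzp, hd⟩
    have hnotMem : ∀ y ∈ uIcc p.2 z.2, (v.x, y) ∉ J := fun y hy =>
      disjoint_left.1 hd ((mem_segment_iff_of_fst_eq hzp.symm).2 ⟨hp.1.symm, hy⟩)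
    refine ⟨hzp.trans hp.1, ?_, ?_⟩ <;> by_contra! hz
    · exact hnotMem v.lo (mem_uIcc_of_ge hz hp.2.1.le) hv.lo_mem
    · exact hnotMem v.hi (mem_uIcc_of_le hp.2.2.le hz) hv.hi_mem
  · rintro ⟨hzx, hz⟩
    refine ⟨hzx.trans hp.1.symm, hv.disjoint.mono_left fun w hw => ?_⟩
    rw [mem_segment_iff_of_fst_eq (hp.1.trans hzx.symm), mem_uIcc] at hw
    rw [VSeg.mem_interior_iff]
    grind

theorem eq_of_interior_eq (hv : IsCrosscut J v) (hv' : IsCrosscut J v')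
    (h : v.interior = v'.interior) : v = v' := by
  have hx : v.x = v'.x := (VSeg.mem_interior_iff.1 (h ▸ hv.midpoint_mem)).1
  have hIoo : Ioo v.lo v.hi = Ioo v'.lo v'.hi := by
    ext y
    simpa [VSeg.mem_interior_iff, hx] using Set.ext_iff.1 h (v.x, y)
  have hlo : v.lo = v'.lo := by rw [← csInf_Ioo hv.lt, hIoo, csInf_Ioo hv'.lt]
  have hhi : v.hi = v'.hi := by rw [← csSup_Ioo hv.lt, hIoo, csSup_Ioo hv'.lt]
  cases v
  cases v'
  simp_all

theorem eq_of_mem (hv : IsCrosscut J v) (hv' : IsCrosscut J v') (hz : z ∈ v.interior)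
    (hz' : z ∈ v'.interior) : v = v' :=
  hv.eq_of_interior_eq hv' ((hv.openSeg_eq hz).symm.trans (hv'.openSeg_eq hz'))

theorem union_eq (hv : IsCrosscut J v) : J ∪ v.interior = J ∪ {v.x} ×ˢ Icc v.lo v.hi := by
  have hIcc : {v.x} ×ˢ Icc v.lo v.hi ⊆ J ∪ v.interior := by
    rintro ⟨x, y⟩ ⟨rfl, hy⟩
    rcases eq_endpoints_or_mem_Ioo_of_mem_Icc hy with rfl | rfl | hy
    · exact Or.inl hv.lo_mem
    · exact Or.inl hv.hi_mem
    · exact Or.inr ⟨rfl, hy⟩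
  refine (union_subset_union_right _ (prod_mono_right Ioo_subset_Icc_self)).antisymm ?_
  exact union_subset subset_union_left hIcc

theorem isClosed_union (hJ : IsClosed J) (hv : IsCrosscut J v) : IsClosed (J ∪ v.interior) := by
  rw [hv.union_eq]
  exact hJ.union (isClosed_singleton.prod isClosed_Icc)

end IsCrosscut

theorem isCrosscut_of_interior_eq_openSeg {v : VSeg} (hp : p ∉ J)
    (h : v.interior = openSeg J p) : IsCrosscut J v := by
  have hpv : p ∈ v.interior := h ▸ mem_openSeg_self hp
  have hdisjoint : Disjoint v.interior J := h ▸ disjoint_openSeg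
  obtain ⟨hpx, hlo, hhi⟩ := VSeg.mem_interior_iff.1 hpv
  have hmem : ∀ y ∈ Icc v.lo v.hi, y ∉ Ioo v.lo v.hi → (v.x, y) ∈ J := by
    intro y hy hy'
    by_contra hyJ
    refine hy' (VSeg.mem_interior_iff.1 (?_ : (v.x, y) ∈ v.interior)).2
    rw [h]
    refine ⟨hpx.symm, disjoint_left.2 fun w hw hwJ => ?_⟩
    rw [mem_segment_iff_of_fst_eq hpx, mem_uIcc] at hw
    obtain hwy | hwy := eq_or_ne w.2 y
    · exact hyJ ((Prod.ext (hw.1.trans hpx) hwy : w = (v.x, y)) ▸ hwJ)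
    · refine disjoint_left.1 hdisjoint (VSeg.mem_interior_iff.2 ⟨hw.1.trans hpx, ?_⟩) hwJ
      simp only [mem_Icc] at hy hw
      grind
  exact ⟨hlo.trans hhi, hdisjoint, hmem _ (left_mem_Icc.2 v.lo_le_hi) left_notMem_Ioo,
    hmem _ (right_mem_Icc.2 v.lo_le_hi) right_notMem_Ioo⟩

/-! ### Rectilinear paths and separation -/

/-- `p` and `q` are joined by a polygonal path of horizontal and vertical segments off `F`. -/
def Reach (F : Set (ℝ × ℝ)) : ℝ × ℝ → ℝ × ℝ → Prop :=
  Relation.ReflTransGen fun p q => (p.1 = q.1 ∨ p.2 = q.2) ∧ Disjoint (segment ℝ p q) F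

namespace Reach

theorem trans (hpq : Reach F p q) (hqr : Reach F q r) : Reach F p r :=
  Relation.ReflTransGen.trans hpq hqr

theorem symm (h : Reach F p q) : Reach F q p := by
  induction h with
  | refl => exact .refl
  | @tail b c _ hstep ih =>
    exact .head ⟨hstep.1.imp Eq.symm Eq.symm, segment_symm ℝ b c ▸ hstep.2⟩ ih

theorem of_horizontal (h : p.2 = q.2) (hd : Disjoint (segment ℝ p q) F) : Reach F p q :=
  .single ⟨Or.inr h, hd⟩

theorem of_vertical (h : p.1 = q.1) (hd : Disjoint (segment ℝ p q) F) : Reach F p q :=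
  .single ⟨Or.inl h, hd⟩

end Reach

/-- The indicator function of the quadrant of points to the right of `p` and below `p`. -/
noncomputable def quadrant (p z : ℝ × ℝ) : ℤ :=
  if z.2 < p.2 ∧ p.1 ≤ z.1 then 1 else 0

theorem eventually_quadrant_sub_eq_of_snd_eq (hpq : p.2 = q.2) (hz : z ∉ segment ℝ p q) :
    ∀ᶠ z' in 𝓝 z, quadrant p z' - quadrant q z' =
      quadrant p (z'.1, z.2) - quadrant q (z'.1, z.2) := by
  rcases lt_trichotomy z.2 p.2 with hlt | heq | hgt
  · filter_upwards [continuous_snd.continuousAt.eventually_lt_const hlt] with z' hz'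
    grind [quadrant]
  · have hz₁ : z.1 ∉ uIcc p.1 q.1 := fun hc => hz ((mem_segment_iff_of_snd_eq hpq).2 ⟨hc, heq⟩)
    filter_upwards [continuous_fst.continuousAt.eventually
      (isClosed_Icc.isOpen_compl.mem_nhds hz₁)] with z' hz'
    have hz' : z'.1 ∉ uIcc p.1 q.1 := hz'
    rw [mem_uIcc] at hz'
    grind [quadrant]
  · filter_upwards [continuous_snd.continuousAt.eventually_const_lt hgt] with z' hz'
    grind [quadrant]

theorem eventually_quadrant_sub_eq_of_fst_eq (hpq : p.1 = q.1) (hz : z ∉ segment ℝ p q) :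
    ∀ᶠ z' in 𝓝 z, quadrant p z' - quadrant q z' =
      quadrant p (z.1, z'.2) - quadrant q (z.1, z'.2) := by
  rcases lt_trichotomy z.1 p.1 with hlt | heq | hgt
  · filter_upwards [continuous_fst.continuousAt.eventually_lt_const hlt] with z' hz'
    grind [quadrant]
  · have hz₂ : z.2 ∉ uIcc p.2 q.2 := fun hc => hz ((mem_segment_iff_of_fst_eq hpq).2 ⟨heq, hc⟩)
    filter_upwards [continuous_snd.continuousAt.eventually
      (isClosed_Icc.isOpen_compl.mem_nhds hz₂)] with z' hz'
    have hz' : z'.2 ∉ uIcc p.2 q.2 := hz'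
    rw [mem_uIcc] at hz'
    grind [quadrant]
  · filter_upwards [continuous_fst.continuousAt.eventually_const_lt hgt] with z' hz'
    grind [quadrant]

/-- `H` behaves like the crossing count of a rectilinear path from `p` to `q` off `F`, where
`H z` is the signed number of horizontal steps of the path that the upward vertical ray from `z`
crosses. The sum of `quadrant a - quadrant b` over the horizontal steps from `a` to `b` is `H`, and
over the vertical steps it is what remains of `quadrant p - quadrant q`. -/
structure IsCrossingCount (F : Set (ℝ × ℝ)) (p q : ℝ × ℝ) (H : ℝ × ℝ → ℤ) : Prop where
  eventually_eq_of_fst : ∀ z ∈ F, ∀ᶠ z' in 𝓝 z, H z' = H (z'.1, z.2)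
  eventually_eq_of_snd : ∀ z ∈ F, ∀ᶠ z' in 𝓝 z,
    quadrant p z' - quadrant q z' - H z' =
      quadrant p (z.1, z'.2) - quadrant q (z.1, z'.2) - H (z.1, z'.2)

namespace IsCrossingCount

variable {H K : ℝ × ℝ → ℤ}

theorem mono (h : IsCrossingCount F p q H) (hGF : G ⊆ F) : IsCrossingCount G p q H :=
  ⟨fun z hz => h.1 z (hGF hz), fun z hz => h.2 z (hGF hz)⟩

theorem zero_of_fst_eq (hpq : p.1 = q.1) (hd : Disjoint (segment ℝ p q) F) :
    IsCrossingCount F p q 0 where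
  eventually_eq_of_fst _ _ := .of_forall fun _ => rfl
  eventually_eq_of_snd z hz := by
    simpa only [Pi.zero_apply, sub_zero] using
      eventually_quadrant_sub_eq_of_fst_eq hpq (disjoint_right.1 hd hz)

theorem quadrant_sub_of_snd_eq (hpq : p.2 = q.2) (hd : Disjoint (segment ℝ p q) F) :
    IsCrossingCount F p q (fun z => quadrant p z - quadrant q z) where
  eventually_eq_of_fst z hz := eventually_quadrant_sub_eq_of_snd_eq hpq (disjoint_right.1 hd hz)
  eventually_eq_of_snd _ _ := .of_forall fun _ => by simp only [sub_self]

theorem add (h : IsCrossingCount F p q H) (h' : IsCrossingCount F q r K) :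
    IsCrossingCount F p r (H + K) where
  eventually_eq_of_fst z hz := by
    filter_upwards [h.1 z hz, h'.1 z hz] with z' hH hK
    rw [Pi.add_apply, Pi.add_apply, hH, hK]
  eventually_eq_of_snd z hz := by
    filter_upwards [h.2 z hz, h'.2 z hz] with z' hH hK
    simp only [Pi.add_apply]
    linarith

theorem continuousOn_of_loop (h : IsCrossingCount F p p H) : ContinuousOn H F := by
  intro z hz
  have heventually : ∀ᶠ z' in 𝓝 z, H z' = H z := by
    filter_upwards [h.1 z hz, (tendsto_mk_fst z).eventually (h.2 z hz)] with z' hfst hsnd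
    rw [hfst]
    simpa using hsnd
  exact ContinuousAt.continuousWithinAt (tendsto_nhds_of_eventually_eq heventually)

theorem eq_of_vertical_subset (h : IsCrossingCount F p q H) {x lo hi : ℝ} (hle : lo ≤ hi)
    (hF : {x} ×ˢ Icc lo hi ⊆ F) : H (x, lo) = H (x, hi) := by
  have hcont : ContinuousOn (fun y => H (x, y)) (Icc lo hi) := by
    intro y hy
    have hmk : Tendsto (fun y' : ℝ => (x, y')) (𝓝 y) (𝓝 (x, y)) :=
      (Continuous.prodMk_right x).continuousAt
    exact ContinuousAt.continuousWithinAt (tendsto_nhds_of_eventually_eq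
      (hmk.eventually (h.1 (x, y) (hF ⟨rfl, hy⟩))))
  exact isPreconnected_Icc.constant hcont (left_mem_Icc.2 hle) (right_mem_Icc.2 hle)

end IsCrossingCount

theorem Reach.exists_isCrossingCount (h : Reach F p q) : ∃ H, IsCrossingCount F p q H := by
  induction h with
  | refl => exact ⟨0, fun _ _ => .of_forall fun _ => rfl, fun _ _ => .of_forall fun _ => by simp⟩
  | tail _ hstep ih =>
    obtain ⟨H, hH⟩ := ih
    rcases hstep with ⟨hfst | hsnd, hd⟩
    · exact ⟨_, hH.add (.zero_of_fst_eq hfst hd)⟩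
    · exact ⟨_, hH.add (.quadrant_sub_of_snd_eq hsnd hd)⟩

/- A path from `p` to `q` off `J ∪ v`, closed up by the segment from `q` to `p`, is a loop off `J`,
so its crossing count is the same at the two endpoints of `v`; yet `v` crosses the loop exactly
once. -/
theorem IsCrosscut.not_reach (hJ : IsPreconnected J) {v : VSeg} (hv : IsCrosscut J v)
    (hpq : p.2 = q.2) (hd : Disjoint (segment ℝ p q) J) (hp : (v.x, p.2) ∈ v.interior)
    (hx : v.x ∈ uIoo p.1 q.1) : ¬ Reach (J ∪ v.interior) p q := by
  intro h
  obtain ⟨H, hH⟩ := h.exists_isCrossingCount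
  have hclosing : IsCrossingCount J q p (fun z => quadrant q z - quadrant p z) :=
    .quadrant_sub_of_snd_eq hpq.symm (segment_symm ℝ p q ▸ hd)
  have hloop := hJ.constant ((hH.mono subset_union_left).add hclosing).continuousOn_of_loop
    hv.lo_mem hv.hi_mem
  have hvertical : H (v.x, v.lo) = H (v.x, v.hi) :=
    hH.eq_of_vertical_subset v.lo_le_hi (hv.union_eq ▸ subset_union_right)
  rw [VSeg.mem_interior_iff] at hp
  rw [mem_uIoo_iff] at hx
  simp only [Pi.add_apply, hvertical, quadrant] at hloop
  grind

theorem eventually_disjoint_segments (hF : IsClosed F) (hp : p ∉ F) :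
    ∀ᶠ z in 𝓝 p, Disjoint (segment ℝ z (z.1, p.2)) F ∧ Disjoint (segment ℝ (z.1, p.2) p) F := by
  obtain ⟨B, ⟨hB, hBconvex⟩, hBF⟩ :=
    (LocallyConvexSpace.convex_basis (𝕜 := ℝ) p).mem_iff.1 (hF.isOpen_compl.mem_nhds hp)
  have hdisjoint : Disjoint B F := disjoint_left.2 fun _ hz => hBF hz
  filter_upwards [hB, (tendsto_mk_fst p).eventually hB] with z hz hz'
  exact ⟨hdisjoint.mono_left (hBconvex.segment_subset hz hz'),
    hdisjoint.mono_left (hBconvex.segment_subset hz' (mem_of_mem_nhds hB))⟩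

theorem eventually_reach (hF : IsClosed F) (hp : p ∉ F) : ∀ᶠ z in 𝓝 p, Reach F z p := by
  filter_upwards [eventually_disjoint_segments hF hp] with z hz
  exact (Reach.of_vertical (by rfl) hz.1).trans (.of_horizontal (by rfl) hz.2)

theorem eventually_mem_openSeg (hJ : IsClosed J) (hp : p ∉ J) :
    ∀ᶠ z in 𝓝 p, (z.1, p.2) ∈ openSeg J z := by
  filter_upwards [eventually_disjoint_segments hJ hp] with z hz
  exact ⟨rfl, hz.1⟩

theorem interior_subset_interior_sweepRegion (hJ : IsClosed J) {t : HSeg}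
    (ht : Disjoint t.interior J) : t.interior ⊆ interior (sweepRegion J t) := by
  intro p hp
  have hp' := HSeg.mem_interior_iff.1 hp
  have hfst : ∀ᶠ z : ℝ × ℝ in 𝓝 p, z.1 ∈ uIoo t.src.1 t.tgt.1 :=
    continuous_fst.continuousAt.eventually (isOpen_Ioo.mem_nhds hp'.1)
  rw [mem_interior_iff_mem_nhds]
  filter_upwards [hfst, eventually_mem_openSeg hJ (disjoint_left.1 ht hp)] with z hz hzp
  have hmem : (z.1, p.2) ∈ t.interior := HSeg.mem_interior_iff.2 ⟨hz, hp'.2⟩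
  exact mem_sweepRegion_iff.2 ⟨_, HSeg.interior_subset_carrier hmem, disjoint_left.1 ht hmem,
    mem_openSeg_comm.1 hzp⟩

theorem frequently_mem_sweepRegion (hJ : IsClosed J) {t : HSeg}
    (hp : p ∈ closure (sweepRegion J t)) (hpJ : p ∉ J) :
    ∃ᶠ a in 𝓝 p.1, (a, p.2) ∈ sweepRegion J t := by
  have hproj : ∃ᶠ z in 𝓝 p, (z.1, p.2) ∈ sweepRegion J t := by
    refine ((mem_closure_iff_frequently.1 hp).and_eventually
      (eventually_mem_openSeg hJ hpJ)).mono fun z hz => ?_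
    exact ⟨_, openSeg_mem_sweep hz.1, hz.2⟩
  exact continuous_fst.continuousAt.frequently hproj

namespace Reach

variable {t : HSeg} {v : VSeg}

theorem of_mem_openSeg (hz : z ∈ openSeg J p) (hF : Disjoint (openSeg J p) F) : Reach F p z :=
  .of_vertical hz.1.symm (hF.mono_left (segment_subset_openSeg hz))

theorem exists_mem_carrier (hv : IsCrosscut J v) (hz : z ∈ sweepRegion J t)
    (hzv : z ∉ v.interior) :
    ∃ p ∈ t.carrier, p ∉ J ∪ v.interior ∧ Reach (J ∪ v.interior) p z := by
  obtain ⟨p, hp, hpJ, hzp⟩ := mem_sweepRegion_iff.1 hz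
  have hdisjoint : Disjoint (openSeg J p) (J ∪ v.interior) := by
    refine disjoint_union_right.2 ⟨disjoint_openSeg, disjoint_left.2 fun w hw hwv => hzv ?_⟩
    rwa [← hv.openSeg_eq hwv, openSeg_eq_of_mem hw]
  exact ⟨p, hp, disjoint_left.1 hdisjoint (mem_openSeg_self hpJ), .of_mem_openSeg hzp hdisjoint⟩

theorem of_mem_sweepRegion (hv : IsCrosscut J v) (ht : Disjoint t.interior (J ∪ v.interior))
    (hz : z ∈ sweepRegion J t \ v.interior) (hw : w ∈ sweepRegion J t \ v.interior) :
    Reach (J ∪ v.interior) z w := by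
  obtain ⟨p, hp, hpF, hpz⟩ := exists_mem_carrier hv hz.1 hz.2
  obtain ⟨q, hq, hqF, hqw⟩ := exists_mem_carrier hv hw.1 hw.2
  have hpq : p.2 = q.2 :=
    (HSeg.mem_carrier_iff.1 hp).2.trans (HSeg.mem_carrier_iff.1 hq).2.symm
  exact (hpz.symm.trans (.of_horizontal hpq (HSeg.disjoint_segment ht hp hq hpF hqF))).trans hqw

end Reach

/-! ### Rays of sweeps -/

/-- The combinatorial data of an infinite ray of the recursion tree: the `n`-th sweep of the ray is
that of `T n`, and `T (n + 1)` starts at the midpoint of the cross-cut `v n` on the boundary of the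
region swept by `T n`. Of the sweeps that precede `T (n + 1)` in the run, only those on the ray are
recorded. -/
structure IsSweepRay (J : Set (ℝ × ℝ)) (T : ℕ → HSeg) (v : ℕ → VSeg) : Prop where
  isCrosscut (n : ℕ) : IsCrosscut J (v n)
  subset_closure (n : ℕ) : (v n).interior ⊆ closure (sweepRegion J (T n))
  disjoint_interior_sweepRegion {k n : ℕ} :
    k ≤ n → Disjoint (v n).interior (interior (sweepRegion J (T k)))
  disjoint_interior (n : ℕ) : Disjoint (T n).interior J
  tgt_mem (n : ℕ) : (T n).tgt ∈ J
  src_zero_mem : (T 0).src ∈ J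
  src_succ (n : ℕ) : (T (n + 1)).src = (v n).midpoint
  disjoint_carrier {k n : ℕ} :
    k ≤ n → Disjoint ((T (n + 1)).carrier \ {(v n).midpoint}) (sweepRegion J (T k))

theorem eventually_mem_uIoo {b c : ℝ} (hbc : c ≠ b) :
    ∀ᶠ a in 𝓝 c, a ≠ c → a ∈ uIoo c b ∨ c ∈ uIoo a b := by
  simp only [mem_uIoo_iff]
  rcases hbc.lt_or_gt with h | h
  · filter_upwards [eventually_lt_nhds h] with a ha hac
    grind
  · filter_upwards [eventually_gt_nhds h] with a ha hac
    grind

theorem uIoo_inter_uIoo_nonempty {a b c d : ℝ} (hb : c ∈ uIoo a b) (hd : c ∈ uIoo a d) :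
    (uIoo c b ∩ uIoo c d).Nonempty := by
  rw [mem_uIoo_iff] at hb hd
  rcases lt_or_ge a c with hac | hac
  · obtain ⟨x, hx⟩ := exists_between (lt_min (by grind : c < b) (by grind : c < d))
    exact ⟨x, by simp only [mem_inter_iff, mem_uIoo_iff]; grind⟩
  · obtain ⟨x, hx⟩ := exists_between (max_lt (by grind : b < c) (by grind : d < c))
    exact ⟨x, by simp only [mem_inter_iff, mem_uIoo_iff]; grind⟩

namespace IsSweepRay

variable {T : ℕ → HSeg} {v : ℕ → VSeg} {k l n : ℕ} {a : ℝ}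

theorem mem_interior_succ (h : IsSweepRay J T v) (ha : a ∈ uIoo (v n).x (T (n + 1)).tgt.1) :
    (a, (v n).midpoint.2) ∈ (T (n + 1)).interior := by
  rw [HSeg.mem_interior_iff, h.src_succ]
  exact ⟨ha, rfl⟩

theorem mem_sweepRegion_succ (h : IsSweepRay J T v)
    (ha : a ∈ uIoo (v n).x (T (n + 1)).tgt.1) :
    (a, (v n).midpoint.2) ∈ sweepRegion J (T (n + 1)) :=
  mem_sweepRegion_of_mem_carrier (HSeg.interior_subset_carrier (h.mem_interior_succ ha))
    (disjoint_left.1 (h.disjoint_interior _) (h.mem_interior_succ ha))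

theorem notMem_sweepRegion_of_mem_interior (h : IsSweepRay J T v) (hkn : k ≤ n)
    (hz : z ∈ (T (n + 1)).interior) : z ∉ sweepRegion J (T k) := by
  refine disjoint_left.1 (h.disjoint_carrier hkn) ⟨HSeg.interior_subset_carrier hz, ?_⟩
  rintro rfl
  exact HSeg.src_notMem_interior (h.src_succ n ▸ hz)

theorem midpoint_notMem (h : IsSweepRay J T v) (n : ℕ) : (v n).midpoint ∉ J :=
  disjoint_left.1 (h.isCrosscut n).disjoint (h.isCrosscut n).midpoint_mem

theorem interior_subset_sweepRegion_succ (h : IsSweepRay J T v) (n : ℕ) :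
    (v n).interior ⊆ sweepRegion J (T (n + 1)) := by
  rw [← (h.isCrosscut n).openSeg_eq (h.isCrosscut n).midpoint_mem]
  intro z hz
  exact mem_sweepRegion_iff.2
    ⟨_, h.src_succ n ▸ HSeg.src_mem_carrier, h.midpoint_notMem n, hz⟩

theorem disjoint_interior_interior (h : IsSweepRay J T v) (hJ : IsClosed J) (k n : ℕ) :
    Disjoint (T k).interior (v n).interior := by
  rcases le_or_gt k n with hkn | hnk
  · exact (h.disjoint_interior_sweepRegion hkn).symm.mono_left
      (interior_subset_interior_sweepRegion hJ (h.disjoint_interior k))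
  obtain ⟨l, rfl⟩ : ∃ l, k = l + 1 := ⟨k - 1, by omega⟩
  refine disjoint_left.2 fun z hz hzv => ?_
  rcases (Nat.lt_succ_iff.1 hnk).eq_or_lt with rfl | hnl
  · have hzx : z.1 = (T (n + 1)).src.1 := by
      rw [h.src_succ, (VSeg.mem_interior_iff.1 hzv).1]
      rfl
    exact left_notMem_uIoo (hzx ▸ (HSeg.mem_interior_iff.1 hz).1)
  · exact h.notMem_sweepRegion_of_mem_interior hnl hz (h.interior_subset_sweepRegion_succ n hzv)

theorem disjoint_interior_union (h : IsSweepRay J T v) (hJ : IsClosed J) (k n : ℕ) :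
    Disjoint (T k).interior (J ∪ (v n).interior) :=
  disjoint_union_right.2 ⟨h.disjoint_interior k, h.disjoint_interior_interior hJ k n⟩

theorem exists_eq_of_mem_sweepRegion (h : IsSweepRay J T v) (hJ : IsClosed J)
    (hz : z ∈ sweepRegion J (T k)) (hzv : z ∈ (v n).interior) : ∃ l, k = l + 1 ∧ v l = v n := by
  obtain ⟨p, hp, hpJ, hzp⟩ := mem_sweepRegion_iff.1 hz
  have hpv : p ∈ (v n).interior := by
    rw [← (h.isCrosscut n).openSeg_eq hzv]
    exact mem_openSeg_comm.1 hzp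
  rcases HSeg.eq_src_or_eq_tgt_or_mem_interior hp with rfl | rfl | hp
  · cases k with
    | zero => exact absurd h.src_zero_mem hpJ
    | succ l =>
      rw [h.src_succ] at hpv
      exact ⟨l, rfl, (h.isCrosscut l).eq_of_mem (h.isCrosscut n) (h.isCrosscut l).midpoint_mem hpv⟩
  · exact absurd (h.tgt_mem k) hpJ
  · exact absurd hpv (disjoint_left.1 (h.disjoint_interior_interior hJ k n) hp)

theorem frequently_mem_sweepRegion (h : IsSweepRay J T v) (hJ : IsClosed J)
    (hn : Disjoint (sweepRegion J (T n)) (v n).interior) :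
    ∃ᶠ a in 𝓝 (v n).x, (a, (v n).midpoint.2) ∈ sweepRegion J (T n) ∧
      (v n).x ∈ uIoo a (T (n + 1)).tgt.1 := by
  have hmem := (h.isCrosscut n).midpoint_mem
  have hne : (v n).x ≠ (T (n + 1)).tgt.1 := by
    have := (T (n + 1)).src_fst_ne_tgt_fst
    rwa [h.src_succ] at this
  refine ((Sweep.frequently_mem_sweepRegion hJ (h.subset_closure n hmem)
    (h.midpoint_notMem n)).and_eventually (eventually_mem_uIoo hne)).mono ?_
  rintro a ⟨ha, hside⟩
  have hax : a ≠ (v n).x := by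
    rintro rfl
    exact disjoint_left.1 hn ha hmem
  exact ⟨ha, (hside hax).resolve_left fun hc =>
    h.notMem_sweepRegion_of_mem_interior le_rfl (h.mem_interior_succ hc) ha⟩

/- The sweeps of `T l` and `T (l + 1)` cover both sides of `v l` near its midpoint, which leaves no
room for a second horizontal segment that starts there. -/
theorem ne_of_lt (h : IsSweepRay J T v) (hJ : IsClosed J) (hln : l < n) : v l ≠ v n := by
  induction l using Nat.strong_induction_on generalizing n with
  | _ l ih =>
  intro heq
  have hl : Disjoint (sweepRegion J (T l)) (v l).interior := by
    refine disjoint_left.2 fun z hz hzv => ?_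
    obtain ⟨j, rfl, hj⟩ := h.exists_eq_of_mem_sweepRegion hJ hz hzv
    exact ih j j.lt_succ_self j.lt_succ_self hj
  have hne : (v l).x ≠ (T (n + 1)).tgt.1 := by
    have := (T (n + 1)).src_fst_ne_tgt_fst
    rwa [h.src_succ, ← heq] at this
  obtain ⟨a, ⟨ha, hal⟩, han⟩ :=
    ((h.frequently_mem_sweepRegion hJ hl).and_eventually (eventually_mem_uIoo hne)).exists
  have hblocked : ∀ c ∈ uIoo (v l).x (T (n + 1)).tgt.1, ∀ k ≤ n,
      (c, (v l).midpoint.2) ∉ sweepRegion J (T k) := by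
    rw [heq]
    exact fun c hc k hk => h.notMem_sweepRegion_of_mem_interior hk (h.mem_interior_succ hc)
  have hax : a ≠ (v l).x := by
    rintro rfl
    exact left_notMem_uIoo hal
  rcases han hax with han | han
  · exact hblocked a han l hln.le ha
  · obtain ⟨c, hcl, hcn⟩ := uIoo_inter_uIoo_nonempty hal han
    exact hblocked c hcn (l + 1) hln (h.mem_sweepRegion_succ hcl)

theorem injective (h : IsSweepRay J T v) (hJ : IsClosed J) : Function.Injective v :=
  .of_lt_imp_ne fun _ _ hln => h.ne_of_lt hJ hln

theorem disjoint_sweepRegion (h : IsSweepRay J T v) (hJ : IsClosed J) (hkn : k ≠ n + 1) :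
    Disjoint (sweepRegion J (T k)) (v n).interior := by
  refine disjoint_left.2 fun z hz hzv => ?_
  obtain ⟨l, rfl, hl⟩ := h.exists_eq_of_mem_sweepRegion hJ hz hzv
  exact hkn (congrArg (· + 1) (h.injective hJ hl))

theorem midpoint_notMem_union (h : IsSweepRay J T v) (hJ : IsClosed J) (hkn : k ≠ n) :
    (v k).midpoint ∉ J ∪ (v n).interior := by
  rintro (hmJ | hmv)
  · exact h.midpoint_notMem k hmJ
  · exact hkn (h.injective hJ
      ((h.isCrosscut k).eq_of_mem (h.isCrosscut n) (h.isCrosscut k).midpoint_mem hmv))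

theorem exists_reach_midpoint (h : IsSweepRay J T v) (hJ : IsClosed J) (hkn : k ≠ n) :
    ∃ z ∈ sweepRegion J (T k) \ (v n).interior,
      Reach (J ∪ (v n).interior) z (v k).midpoint := by
  have hclosed := (h.isCrosscut n).isClosed_union hJ
  have hm := h.midpoint_notMem_union hJ hkn
  have hfrequently := mem_closure_iff_frequently.1
    (h.subset_closure k (h.isCrosscut k).midpoint_mem)
  obtain ⟨z, hz, hzF, hreach⟩ := (hfrequently.and_eventually
    ((hclosed.isOpen_compl.eventually_mem hm).and (eventually_reach hclosed hm))).exists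
  exact ⟨z, ⟨hz, fun hzv => hzF (Or.inr hzv)⟩, hreach⟩

theorem reach_of_le (h : IsSweepRay J T v) (hJ : IsClosed J) (hlk : l ≤ k) (hn : k ≤ n ∨ n < l)
    (hz : z ∈ sweepRegion J (T l) \ (v n).interior)
    (hw : w ∈ sweepRegion J (T k) \ (v n).interior) : Reach (J ∪ (v n).interior) z w := by
  induction k, hlk using Nat.le_induction generalizing w with
  | base =>
    exact .of_mem_sweepRegion (h.isCrosscut n) (h.disjoint_interior_union hJ l n) hz hw
  | succ k hlk ih =>
    have hkn : k ≠ n := by omega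
    obtain ⟨z', hz', hreach⟩ := h.exists_reach_midpoint hJ hkn
    have hm : (v k).midpoint ∈ sweepRegion J (T (k + 1)) \ (v n).interior :=
      ⟨h.interior_subset_sweepRegion_succ k (h.isCrosscut k).midpoint_mem,
        fun hmv => h.midpoint_notMem_union hJ hkn (Or.inr hmv)⟩
    exact ((ih (by omega) hz').trans hreach).trans
      (.of_mem_sweepRegion (h.isCrosscut n) (h.disjoint_interior_union hJ _ n) hm hw)

theorem exists_disjoint_segment (h : IsSweepRay J T v) (hJ : IsClosed J) (n : ℕ) :
    ∃ a b, (a, (v n).midpoint.2) ∈ sweepRegion J (T n) ∧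
      (b, (v n).midpoint.2) ∈ sweepRegion J (T (n + 1)) ∧ (v n).x ∈ uIoo a b ∧
      Disjoint (segment ℝ (a, (v n).midpoint.2) (b, (v n).midpoint.2)) J := by
  have hmk : Tendsto (fun a => (a, (v n).midpoint.2)) (𝓝 (v n).x) (𝓝 (v n).midpoint) :=
    (Continuous.prodMk_left _).continuousAt
  obtain ⟨a, ⟨ha, hax⟩, -, hdisjoint⟩ := ((h.frequently_mem_sweepRegion hJ
    (h.disjoint_sweepRegion hJ n.lt_succ_self.ne)).and_eventually
    (hmk.eventually (eventually_disjoint_segments hJ (h.midpoint_notMem n)))).exists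
  obtain ⟨b, hb, -⟩ := uIoo_inter_uIoo_nonempty hax hax
  refine ⟨a, b, ha, h.mem_sweepRegion_succ hb, ?_, disjoint_left.2 fun z hz hzJ => ?_⟩
  · simp only [mem_uIoo_iff] at *
    grind
  rw [mem_segment_iff_of_snd_eq (by rfl)] at hz
  obtain hzx | hzx : z.1 ∈ uIcc a (v n).x ∨ z.1 ∈ uIoo (v n).x (T (n + 1)).tgt.1 := by
    rw [mem_uIoo_iff] at *
    rw [mem_uIcc] at *
    grind
  · exact disjoint_left.1 hdisjoint ((mem_segment_iff_of_snd_eq (by rfl)).2 ⟨hzx, hz.2⟩) hzJ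
  · have hzT : z ∈ (T (n + 1)).interior :=
      (Prod.ext rfl hz.2 : z = (z.1, (v n).midpoint.2)) ▸ h.mem_interior_succ hzx
    exact disjoint_left.1 (h.disjoint_interior (n + 1)) hzT hzJ

theorem not_reach (h : IsSweepRay J T v) (hJ : IsClosed J) (hJ' : IsPreconnected J) (hkn : k ≤ n)
    (hnl : n < l) (hz : z ∈ sweepRegion J (T k) \ (v n).interior)
    (hw : w ∈ sweepRegion J (T l) \ (v n).interior) : ¬ Reach (J ∪ (v n).interior) z w := by
  intro hreach
  obtain ⟨a, b, ha, hb, hx, hdisjoint⟩ := h.exists_disjoint_segment hJ n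
  have hnotMem : ∀ c, c ≠ (v n).x → (c, (v n).midpoint.2) ∉ (v n).interior :=
    fun c hc hcv => hc (VSeg.mem_interior_iff.1 hcv).1
  have hp := And.intro ha (hnotMem a fun hc => left_notMem_uIoo (hc ▸ hx))
  have hq := And.intro hb (hnotMem b fun hc => right_notMem_uIoo (hc ▸ hx))
  refine (h.isCrosscut n).not_reach hJ' (by rfl) hdisjoint (h.isCrosscut n).midpoint_mem hx ?_
  exact ((h.reach_of_le hJ hkn (Or.inl le_rfl) hz hp).symm.trans hreach).trans
    (h.reach_of_le hJ hnl (Or.inr n.lt_succ_self) hq hw).symm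

end IsSweepRay

/-! ### One-sided limits of cross-cuts -/

/-- The open half-plane bounded by the vertical line at `x`: the left one for `ε > 0` and the right
one for `ε < 0`. -/
def halfPlane (ε x : ℝ) : Set (ℝ × ℝ) := {z | ε * z.1 < ε * x}

/-- The vertical segments `σ k` lie in `halfPlane ε s.x` and converge to `s`, in the sense of
convergence of both endpoints. -/
structure TendstoFromSide (ε : ℝ) (σ : ℕ → VSeg) (s : VSeg) : Prop where
  mul_lt (k : ℕ) : ε * (σ k).x < ε * s.x
  tendsto_x : Tendsto (fun k => (σ k).x) atTop (𝓝 s.x)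
  tendsto_lo : Tendsto (fun k => (σ k).lo) atTop (𝓝 s.lo)
  tendsto_hi : Tendsto (fun k => (σ k).hi) atTop (𝓝 s.hi)

variable {ε x : ℝ} {σ : ℕ → VSeg} {s : VSeg}

theorem isOpen_halfPlane : IsOpen (halfPlane ε x) :=
  isOpen_lt (by fun_prop) continuous_const

theorem convex_halfPlane : Convex ℝ (halfPlane ε x) :=
  convex_halfSpace_lt (ε • LinearMap.fst ℝ ℝ ℝ).isLinear _

theorem mem_uIcc_of_mul_lt {a b c : ℝ} (hab : ε * a < ε * b) (hbc : ε * b < ε * c) :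
    b ∈ uIcc a c := by
  rcases lt_trichotomy ε 0 with hε | rfl | hε
  · rw [mul_lt_mul_left_of_neg hε] at hab hbc
    exact mem_uIcc_of_ge hbc.le hab.le
  · simp at hab
  · rw [mul_lt_mul_iff_right₀ hε] at hab hbc
    exact mem_uIcc_of_le hab.le hbc.le

theorem exists_mul_lt_of_frequently_ne {f : ℕ → ℝ} (h : ∃ᶠ k in atTop, f k ≠ x) :
    ∃ ε, ∃ ψ : ℕ → ℕ, StrictMono ψ ∧ ∀ k, ε * f (ψ k) < ε * x := by
  simp only [ne_iff_lt_or_gt, frequently_or_distrib] at h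
  rcases h with h | h
  · obtain ⟨ψ, hψ, hlt⟩ := extraction_of_frequently_atTop h
    exact ⟨1, ψ, hψ, by simpa using hlt⟩
  · obtain ⟨ψ, hψ, hlt⟩ := extraction_of_frequently_atTop h
    exact ⟨-1, ψ, hψ, by simpa using hlt⟩

theorem exists_isOpen_convex_subset {E : Type*} [AddCommGroup E] [Module ℝ E] [TopologicalSpace E]
    [IsTopologicalAddGroup E] [ContinuousSMul ℝ E] [LocallyConvexSpace ℝ E] {C S : Set E} {p : E}
    (hC : IsOpen C) (hC' : Convex ℝ C) (hS : S ∈ 𝓝[C] p) :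
    ∃ Q ∈ 𝓝[C] p, IsOpen Q ∧ Convex ℝ Q ∧ Q ⊆ S := by
  obtain ⟨U, hU, hUS⟩ := mem_nhdsWithin_iff_exists_mem_nhds_inter.1 hS
  obtain ⟨V, ⟨hV, hV'⟩, hVU⟩ := (LocallyConvexSpace.convex_basis (𝕜 := ℝ) p).mem_iff.1 hU
  exact ⟨interior V ∩ C,
    inter_mem (mem_nhdsWithin_of_mem_nhds (interior_mem_nhds.2 hV)) self_mem_nhdsWithin,
    isOpen_interior.inter hC, hV'.interior.inter hC',
    (inter_subset_inter_left C (interior_subset.trans hVU)).trans hUS⟩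

section

variable {X : Type*} [TopologicalSpace X] [CompactSpace X] [LocallyConnectedSpace X]
  {γ : X → ℝ × ℝ}

/- Otherwise a short arc of the curve, which stays between the heights of the `σ k`, would have to
cross one of them on its way to the limit. -/
theorem TendstoFromSide.compl_range_mem_nhdsWithin (h : TendstoFromSide ε σ s)
    (hγ : Continuous γ) (hσ : ∀ k, IsCrosscut (range γ) (σ k)) (hz : z ∈ s.interior) :
    (range γ)ᶜ ∈ 𝓝[halfPlane ε s.x] z := by
  suffices hfiber : ∀ θ₀ ∈ γ ⁻¹' {z}, ∀ᶠ θ in 𝓝 θ₀, γ θ ∉ halfPlane ε s.x by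
    rw [mem_nhdsWithin_iff_eventually]
    filter_upwards [hγ.isClosedMap.eventually_nhds_fiber z hfiber] with w hw hside
    rintro ⟨θ, rfl⟩
    exact hw θ rfl hside
  rintro θ₀ rfl
  obtain ⟨hx₀, hlo, hhi⟩ := VSeg.mem_interior_iff.1 hz
  obtain ⟨lo', hlo', hlo''⟩ := exists_between hlo
  obtain ⟨hi', hhi', hhi''⟩ := exists_between hhi
  have hheight : {θ | (γ θ).2 ∈ Ioo lo' hi'} ∈ 𝓝 θ₀ :=
    hγ.snd.continuousAt.eventually (Ioo_mem_nhds hlo'' hhi')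
  obtain ⟨U, hU, hUconn, hUsub⟩ :=
    locallyConnectedSpace_iff_connected_subsets.1 inferInstance θ₀ _ hheight
  filter_upwards [hU] with θ hθ hside
  obtain ⟨k, hkx, hklo, hkhi⟩ := (((h.tendsto_x.const_mul ε).eventually_const_lt hside).and
    ((h.tendsto_lo.eventually_lt_const hlo').and (h.tendsto_hi.eventually_const_lt hhi''))).exists
  have hattained : (σ k).x ∈ (fun τ => (γ τ).1) '' U :=
    (hUconn.image _ hγ.fst.continuousOn).ordConnected.uIcc_subset (mem_image_of_mem _ hθ)
      ⟨θ₀, mem_of_mem_nhds hU, hx₀⟩ (mem_uIcc_of_mul_lt hkx (h.mul_lt k))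
  obtain ⟨τ, hτ, hτx⟩ := hattained
  have hτ' := hUsub hτ
  exact disjoint_left.1 (hσ k).disjoint
    (VSeg.mem_interior_iff.2 ⟨hτx, hklo.trans hτ'.1, hτ'.2.trans hkhi⟩) (mem_range_self τ)

end

/-! ### Accumulation of the sweeps of a ray -/

namespace IsSweepRay

variable {T : ℕ → HSeg} {v : ℕ → VSeg} {k l n : ℕ} {Q C : Set (ℝ × ℝ)} {φ : ℕ → ℕ} {a : ℕ → ℝ}

theorem eventually_mem_inter_of_convex (h : IsSweepRay J T v) (hJ : IsClosed J)
    (hJ' : IsPreconnected J) (hQ : Convex ℝ Q) (hQJ : Disjoint Q J) (hφ : Tendsto φ atTop atTop)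
    {y : ℝ} (ha : ∀ᶠ k in atTop, (a k, y) ∈ Q ∩ sweepRegion J (T (φ k))) :
    ∀ᶠ n in atTop, ((v n).x, y) ∈ Q ∩ (v n).interior := by
  obtain ⟨K, hKQ, hK⟩ := ha.exists
  filter_upwards [eventually_ge_atTop (φ K)] with n hn
  obtain ⟨k, ⟨hkQ, hk⟩, hnk⟩ := (ha.and (hφ.eventually_gt_atTop n)).exists
  have hsegment := hQ.segment_subset hKQ hkQ
  obtain ⟨z, hz, hzv⟩ : ∃ z ∈ segment ℝ (a K, y) (a k, y), z ∈ (v n).interior := by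
    by_contra! hnotMem
    refine h.not_reach hJ hJ' hn hnk ⟨hK, hnotMem _ (left_mem_segment ..)⟩
      ⟨hk, hnotMem _ (right_mem_segment ..)⟩ (.of_horizontal (by rfl) ?_)
    exact disjoint_union_right.2 ⟨hQJ.mono_left hsegment, disjoint_left.2 hnotMem⟩
  have hzy : z = ((v n).x, y) := Prod.ext (VSeg.mem_interior_iff.1 hzv).1
    ((mem_segment_iff_of_snd_eq (by rfl)).1 hz).2
  exact hzy ▸ ⟨hsegment hz, hzv⟩

theorem tendsto_nhdsWithin (h : IsSweepRay J T v) (hJ : IsClosed J) (hJ' : IsPreconnected J)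
    (hC : IsOpen C) (hC' : Convex ℝ C) (hCJ : Jᶜ ∈ 𝓝[C] p) (hφ : Tendsto φ atTop atTop)
    (ha : Tendsto (fun k => (a k, p.2)) atTop (𝓝[C] p))
    (hmem : ∀ᶠ k in atTop, (a k, p.2) ∈ sweepRegion J (T (φ k))) :
    Tendsto (fun n => ((v n).x, p.2)) atTop (𝓝[C] p) ∧
      ∀ᶠ n in atTop, ((v n).x, p.2) ∈ (v n).interior := by
  have heventually : ∀ S ∈ 𝓝[C] p, ∀ᶠ n in atTop, ((v n).x, p.2) ∈ S ∩ (v n).interior := by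
    intro S hS
    obtain ⟨Q, hQ, -, hQ', hQS⟩ := exists_isOpen_convex_subset hC hC' (inter_mem hS hCJ)
    filter_upwards [h.eventually_mem_inter_of_convex hJ hJ' hQ'
      (disjoint_left.2 fun _ hz => (hQS hz).2) hφ ((ha.eventually hQ).and hmem)] with n hn
    exact ⟨(hQS hn.1).1, hn.2⟩
  exact ⟨fun S hS => (heventually S hS).mono fun _ hn => hn.1,
    (heventually univ univ_mem).mono fun _ hn => hn.2⟩

theorem notMem_uIoo_of_convex (h : IsSweepRay J T v) (hJ : IsClosed J) (hJ' : IsPreconnected J)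
    (hQ : IsOpen Q) (hQ' : Convex ℝ Q) (hQJ : Disjoint Q J) (hm : (v n).midpoint ∈ Q) (hnl : n < l)
    {b : ℝ} (hb : (b, (v n).midpoint.2) ∈ Q ∩ sweepRegion J (T l)) :
    (v n).x ∉ uIoo b (T (n + 1)).tgt.1 := by
  intro hbx
  have hQ_nhds : ∀ᶠ c in 𝓝 (v n).x, (c, (v n).midpoint.2) ∈ Q :=
    (Continuous.prodMk_left _).continuousAt.eventually (hQ.mem_nhds hm)
  obtain ⟨c, ⟨hc, hcx⟩, hcQ⟩ := ((h.frequently_mem_sweepRegion hJ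
    (h.disjoint_sweepRegion hJ n.lt_succ_self.ne)).and_eventually hQ_nhds).exists
  have hoff : Disjoint (segment ℝ (c, (v n).midpoint.2) (b, (v n).midpoint.2))
      (v n).interior := by
    refine disjoint_left.2 fun z hz hzv => ?_
    have hzx := ((mem_segment_iff_of_snd_eq (by rfl)).1 hz).1
    rw [(VSeg.mem_interior_iff.1 hzv).1, mem_uIcc] at hzx
    rw [mem_uIoo_iff] at hcx hbx
    grind
  refine h.not_reach hJ hJ' le_rfl hnl ⟨hc, disjoint_left.1 hoff (left_mem_segment ..)⟩
    ⟨hb.2, disjoint_left.1 hoff (right_mem_segment ..)⟩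
    (.of_horizontal (by rfl) (disjoint_union_right.2 ⟨?_, hoff⟩))
  exact hQJ.mono_left (hQ'.segment_subset hcQ hb.1)

/- The segment `T (n + 1)` can neither end before it reaches `v k`, nor cross it, nor leave from the
midpoint of `v n` in the other direction. -/
theorem notMem_interior_of_convex (h : IsSweepRay J T v) (hJ : IsClosed J)
    (hJ' : IsPreconnected J) (hQ : IsOpen Q) (hQ' : Convex ℝ Q) (hQJ : Disjoint Q J)
    (hm : (v n).midpoint ∈ Q) (hnk : n < k) (hk : ((v k).x, (v n).midpoint.2) ∈ Q) :
    ((v k).x, (v n).midpoint.2) ∉ (v k).interior := by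
  intro hkv
  have hne : (v k).x ≠ (v n).x := fun hx =>
    h.midpoint_notMem_union hJ hnk.ne (Or.inr (by rwa [hx] at hkv))
  obtain hcross | hend | haway : (v k).x ∈ uIoo (v n).x (T (n + 1)).tgt.1 ∨
      (T (n + 1)).tgt.1 ∈ uIcc (v n).x (v k).x ∨
      (v n).x ∈ uIoo (v k).x (T (n + 1)).tgt.1 := by
    simp only [mem_uIoo_iff, mem_uIcc]
    grind
  · exact disjoint_left.1 (h.disjoint_interior_interior hJ _ _) (h.mem_interior_succ hcross) hkv
  · have htgt : (T (n + 1)).tgt.2 = (v n).midpoint.2 := by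
      rw [← (T (n + 1)).horizontal, h.src_succ]
    exact disjoint_left.1 hQJ (hQ'.segment_subset hm hk
      ((mem_segment_iff_of_snd_eq (by rfl)).2 ⟨hend, htgt⟩)) (h.tgt_mem (n + 1))
  · exact h.notMem_uIoo_of_convex hJ hJ' hQ hQ' hQJ hm (hnk.trans k.lt_succ_self)
      ⟨hk, h.interior_subset_sweepRegion_succ k hkv⟩ haway

theorem notMem_of_mem_of_mem (h : IsSweepRay J T v) (hJ : IsClosed J) {i j k : ℕ} (hij : i < j)
    (hjk : j < k) (hi : z ∈ sweepRegion J (T i)) (hj : z ∈ sweepRegion J (T j)) :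
    z ∉ sweepRegion J (T k) := by
  obtain ⟨l, rfl⟩ : ∃ l, j = l + 1 := ⟨j - 1, by omega⟩
  suffices hzv : z ∈ (v l).interior from fun hk =>
    disjoint_left.1 (h.disjoint_sweepRegion hJ hjk.ne') hk hzv
  obtain ⟨p, hp, -, hzp⟩ := mem_sweepRegion_iff.1 hj
  have hpm : p = (v l).midpoint := by
    by_contra hpm
    refine disjoint_left.1 (h.disjoint_carrier (Nat.le_of_lt_succ hij)) ⟨hp, hpm⟩ ?_
    exact mem_sUnion_of_mem (mem_openSeg_comm.1 hzp) (openSeg_mem_sweep hi)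
  rwa [← (h.isCrosscut l).openSeg_eq (h.isCrosscut l).midpoint_mem, ← hpm]

theorem frequently_x_ne (h : IsSweepRay J T v) (hJ : IsClosed J) (hφ : StrictMono φ)
    (hσT : ∀ k, (σ k).interior ⊆ sweepRegion J (T (φ k))) (hs : s.lo < s.hi)
    (hlo : Tendsto (fun k => (σ k).lo) atTop (𝓝 s.lo))
    (hhi : Tendsto (fun k => (σ k).hi) atTop (𝓝 s.hi)) : ∃ᶠ k in atTop, (σ k).x ≠ x := by
  intro hx
  obtain ⟨y, hy⟩ := exists_between hs
  have hmem : ∀ᶠ k in atTop, (x, y) ∈ sweepRegion J (T (φ k)) := by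
    filter_upwards [hx, hlo.eventually_lt_const hy.1, hhi.eventually_const_lt hy.2]
      with k hkx hklo hkhi
    exact hσT k (VSeg.mem_interior_iff.2 ⟨(not_not.1 hkx).symm, hklo, hkhi⟩)
  obtain ⟨K, hK⟩ := eventually_atTop.1 hmem
  exact h.notMem_of_mem_of_mem hJ (hφ K.lt_succ_self) (hφ (K + 1).lt_succ_self) (hK K le_rfl)
    (hK (K + 1) (by omega)) (hK (K + 2) (by omega))

section

variable {X : Type*} [TopologicalSpace X] [CompactSpace X] [PreconnectedSpace X]
  [LocallyConnectedSpace X] {γ : X → ℝ × ℝ} {ψ : ℕ → ℕ}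

theorem not_tendstoFromSide_crosscuts (h : IsSweepRay (range γ) T v) (hγ : Continuous γ)
    (hψ : StrictMono ψ) (hs : s.lo < s.hi) : ¬ TendstoFromSide ε (fun k => v (ψ k)) s := by
  intro hlim
  have hJ := (isCompact_range hγ).isClosed
  have hmid : s.midpoint ∈ s.interior :=
    VSeg.mem_interior_iff.2 ⟨rfl, left_lt_add_div_two.2 hs, add_div_two_lt_right.2 hs⟩
  obtain ⟨Q, hQ, hQo, hQc, hQJ⟩ := exists_isOpen_convex_subset isOpen_halfPlane convex_halfPlane
    (hlim.compl_range_mem_nhdsWithin hγ (fun k => h.isCrosscut (ψ k)) hmid)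
  have hmid_snd : Tendsto (fun k => (v (ψ k)).midpoint.2) atTop (𝓝 s.midpoint.2) :=
    (hlim.tendsto_lo.add hlim.tendsto_hi).div_const 2
  have hmem_Q : ∀ᶠ i : ℕ × ℕ in atTop ×ˢ atTop, ((v (ψ i.2)).x, (v (ψ i.1)).midpoint.2) ∈ Q := by
    refine Tendsto.eventually ?_ hQ
    exact tendsto_nhdsWithin_iff.2 ⟨((hlim.tendsto_x.comp tendsto_snd).prodMk_nhds
      (hmid_snd.comp tendsto_fst)), .of_forall fun i => hlim.mul_lt i.2⟩
  have hmem_interior : ∀ᶠ i : ℕ × ℕ in atTop ×ˢ atTop,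
      ((v (ψ i.2)).x, (v (ψ i.1)).midpoint.2) ∈ (v (ψ i.2)).interior := by
    filter_upwards [(hlim.tendsto_lo.comp tendsto_snd).eventually_lt (hmid_snd.comp tendsto_fst)
      (VSeg.mem_interior_iff.1 hmid).2.1, (hmid_snd.comp tendsto_fst).eventually_lt
      (hlim.tendsto_hi.comp tendsto_snd) (VSeg.mem_interior_iff.1 hmid).2.2] with i hlo hhi
    exact VSeg.mem_interior_iff.2 ⟨rfl, hlo, hhi⟩
  have hmid_Q : ∀ᶠ i in atTop, (v (ψ i)).midpoint ∈ Q :=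
    (tendsto_id.prodMk tendsto_id).eventually hmem_Q
  obtain ⟨i, hi, hik⟩ := (hmid_Q.and (hmem_Q.and hmem_interior).curry).exists
  obtain ⟨k, ⟨hkQ, hkv⟩, hik⟩ := (hik.and (eventually_gt_atTop i)).exists
  exact h.notMem_interior_of_convex hJ (isPreconnected_range hγ) hQo hQc
    (disjoint_left.2 hQJ) hi (hψ hik) hkQ hkv

theorem exists_tendstoFromSide_crosscuts (h : IsSweepRay J T v) (hJ : IsCompact J)
    (hCJ : Jᶜ ∈ 𝓝[halfPlane ε p.1] p)
    (hx : Tendsto (fun n => ((v n).x, p.2)) atTop (𝓝[halfPlane ε p.1] p))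
    (hmem : ∀ᶠ n in atTop, ((v n).x, p.2) ∈ (v n).interior) :
    ∃ ψ : ℕ → ℕ, StrictMono ψ ∧ ∃ s : VSeg, s.lo < s.hi ∧
      TendstoFromSide ε (fun k => v (ψ k)) s := by
  rw [tendsto_nhdsWithin_iff] at hx
  obtain ⟨N, hN, hside⟩ := extraction_of_eventually_atTop (hx.2.and hmem)
  obtain ⟨c, -, ψ, hψ, hc⟩ := (hJ.prod hJ).tendsto_subseq
    (x := fun n => (((v (N n)).x, (v (N n)).lo), ((v (N n)).x, (v (N n)).hi)))
    (fun n => ⟨(h.isCrosscut _).lo_mem, (h.isCrosscut _).hi_mem⟩)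
  have hNψ := hN.comp hψ
  have hvx : Tendsto (fun k => (v (N (ψ k))).x) atTop (𝓝 p.1) :=
    hx.1.fst_nhds.comp hNψ.tendsto_atTop
  have hne : ∀ {f : ℕ → ℝ} {y : ℝ}, (∀ k, ((v (N (ψ k))).x, f k) ∈ J) →
      Tendsto f atTop (𝓝 y) → y ≠ p.2 := by
    rintro f _ hfJ hf rfl
    have hlim : Tendsto (fun k => ((v (N (ψ k))).x, f k)) atTop (𝓝[halfPlane ε p.1] p) :=
      tendsto_nhdsWithin_iff.2 ⟨hvx.prodMk_nhds hf, .of_forall fun k => (hside (ψ k)).1⟩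
    obtain ⟨k, hk⟩ := (hlim.eventually hCJ).exists
    exact hk (hfJ k)
  have hlo := hc.fst_nhds.snd_nhds
  have hhi := hc.snd_nhds.snd_nhds
  have hspan := fun k => (VSeg.mem_interior_iff.1 (hside (ψ k)).2).2
  have hlo_lt : c.1.2 < p.2 := (le_of_tendsto' hlo fun k => (hspan k).1.le).lt_of_ne
    (hne (fun k => (h.isCrosscut _).lo_mem) hlo)
  have hlt_hi : p.2 < c.2.2 := (ge_of_tendsto' hhi fun k => (hspan k).2.le).lt_of_ne'
    (hne (fun k => (h.isCrosscut _).hi_mem) hhi)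
  have hlt := hlo_lt.trans hlt_hi
  exact ⟨N ∘ ψ, hNψ, ⟨p.1, c.1.2, c.2.2, hlt.le⟩, hlt, fun k => (hside (ψ k)).1, hvx, hlo, hhi⟩

theorem not_tendstoFromSide (h : IsSweepRay (range γ) T v) (hγ : Continuous γ)
    (hφ : StrictMono φ) (hσ : ∀ k, IsCrosscut (range γ) (σ k))
    (hσT : ∀ k, (σ k).interior ⊆ sweepRegion (range γ) (T (φ k))) (hs : s.lo < s.hi) :
    ¬ TendstoFromSide ε σ s := by
  intro hlim
  have hJ := isCompact_range hγ
  obtain ⟨y, hy⟩ := exists_between hs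
  have hCJ := hlim.compl_range_mem_nhdsWithin hγ hσ
    (VSeg.mem_interior_iff.2 ⟨rfl, hy⟩ : (s.x, y) ∈ s.interior)
  have hσx : Tendsto (fun k => ((σ k).x, y)) atTop (𝓝[halfPlane ε s.x] (s.x, y)) :=
    tendsto_nhdsWithin_iff.2
      ⟨hlim.tendsto_x.prodMk_nhds tendsto_const_nhds, .of_forall hlim.mul_lt⟩
  have hσy : ∀ᶠ k in atTop, ((σ k).x, y) ∈ sweepRegion (range γ) (T (φ k)) := by
    filter_upwards [hlim.tendsto_lo.eventually_lt_const hy.1,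
      hlim.tendsto_hi.eventually_const_lt hy.2] with k hlo hhi
    exact hσT k (VSeg.mem_interior_iff.2 ⟨rfl, hlo, hhi⟩)
  obtain ⟨hx, hmem⟩ := h.tendsto_nhdsWithin hJ.isClosed (isPreconnected_range hγ)
    isOpen_halfPlane convex_halfPlane hCJ hφ.tendsto_atTop hσx hσy
  obtain ⟨ψ, hψ, s', hs', hlim'⟩ := h.exists_tendstoFromSide_crosscuts hJ hCJ hx hmem
  exact h.not_tendstoFromSide_crosscuts hγ hψ hs' hlim'

end

end IsSweepRay

/-- `s` is the limit, in the sense of convergence of both endpoints, of open segments taken from a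
subsequence of the sweeps of `T`. -/
def IsLimitOfSweeps (J : Set (ℝ × ℝ)) (T : ℕ → HSeg) (s : VSeg) : Prop :=
  ∃ φ : ℕ → ℕ, StrictMono φ ∧ ∃ σ : ℕ → VSeg,
    (∀ k, (σ k).interior ∈ sweep J (T (φ k))) ∧
    Tendsto (fun k => (σ k).x) atTop (𝓝 s.x) ∧
    Tendsto (fun k => (σ k).lo) atTop (𝓝 s.lo) ∧
    Tendsto (fun k => (σ k).hi) atTop (𝓝 s.hi)

theorem GreedyRun.IsRootRay.exists_isSweepRay {pstar : ℝ × ℝ} {R : GreedyRun J pstar}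
    {r : ℕ → R.Node} (hr : R.IsRootRay r) :
    ∃ v, IsSweepRay J (fun n => R.t (r n).1) v := by
  obtain ⟨hroot, hchild⟩ := hr
  choose i hi hri hu using hchild
  have hsteps (n : ℕ) : (i n : ℕ∞) < R.steps :=
    (Nat.cast_lt.2 (hi n ▸ (i n).lt_succ_self)).trans_le (r (n + 1)).2
  have hmono : Monotone fun n => (r n).1 :=
    monotone_nat_of_le_succ fun n => by have := hi n; have := hri n; omega
  have hzero : R.t (r 0).1 = R.t 0 := congrArg (R.t ·.1) hroot
  have hswept {k n : ℕ} (hkn : k ≤ n) : sweepRegion J (R.t (r k).1) ⊆ swept J R.t (i n) :=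
    subset_iUnion₂_of_subset _ ((hmono hkn).trans (hri n)) subset_rfl
  exact ⟨fun n => R.u (i n), {
    isCrosscut n := ⟨(hu n).1, (hu n).2.2.1, (hu n).2.2.2.1, (hu n).2.2.2.2⟩
    subset_closure n := (hu n).2.1.trans frontier_subset_closure
    disjoint_interior_sweepRegion hkn := disjoint_interior_frontier.symm.mono
      (R.choice _ (hsteps _)).2.1 (interior_mono (hswept hkn))
    disjoint_interior
      | 0 => hzero ▸ R.first_interior
      | n + 1 => hi n ▸ R.next_interior _ (hsteps n)
    tgt_mem
      | 0 => hzero ▸ R.first_tgt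
      | n + 1 => hi n ▸ R.next_tgt _ (hsteps n)
    src_zero_mem := hzero ▸ R.first_src
    src_succ n := hi n ▸ R.next_src _ (hsteps n)
    disjoint_carrier {k n} hkn := disjoint_compl_left.mono
      (hi n ▸ R.next_exterior _ (hsteps n)) ((hswept hkn).trans subset_closure) }⟩

theorem locallyConnectedSpace_circle : LocallyConnectedSpace Circle :=
  ChartedSpace.locallyConnectedSpace (EuclideanSpace ℝ (Fin 1)) Circle

end Sweep

theorem mainTheorem2_general {X : Type*} [TopologicalSpace X] [CompactSpace X]
    [PreconnectedSpace X] [LocallyConnectedSpace X] {γ : X → ℝ × ℝ} (hγ : Continuous γ)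
    {T : ℕ → Sweep.HSeg} {v : ℕ → Sweep.VSeg} (h : Sweep.IsSweepRay (range γ) T v)
    {s : Sweep.VSeg} (hs : Sweep.IsLimitOfSweeps (range γ) T s) : s.length = 0 := by
  obtain ⟨φ, hφ, σ, hσ, hx, hlo, hhi⟩ := hs
  refine sub_eq_zero.2 (s.lo_le_hi.antisymm' (not_lt.1 fun hlt => ?_))
  have hcrosscut (k : ℕ) : Sweep.IsCrosscut (range γ) (σ k) := by
    obtain ⟨p, -, hp, hσp⟩ := hσ k
    exact Sweep.isCrosscut_of_interior_eq_openSeg hp hσp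
  have hσT (k : ℕ) : (σ k).interior ⊆ Sweep.sweepRegion (range γ) (T (φ k)) :=
    subset_sUnion_of_mem (hσ k)
  obtain ⟨ε, ψ, hψ, hside⟩ := Sweep.exists_mul_lt_of_frequently_ne
    (h.frequently_x_ne (isCompact_range hγ).isClosed hφ hσT hlt hlo hhi (x := s.x))
  have hψ' := hψ.tendsto_atTop
  exact h.not_tendstoFromSide hγ (hφ.comp hψ) (fun k => hcrosscut (ψ k)) (fun k => hσT (ψ k)) hlt
    ⟨hside, hx.comp hψ', hlo.comp hψ', hhi.comp hψ'⟩

theorem mainTheorem2 (J : Set (ℝ × ℝ)) (hJ : Sweep.IsJordanCurve J)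
    (pstar : ℝ × ℝ) (hp : pstar ∉ J)
    (hfin : ∀ s ∈ Sweep.segClass J pstar, Bornology.IsBounded s)
    (R : Sweep.GreedyRun J pstar) :
    ¬ ∃ r : ℕ → R.Node, R.IsRootRay r ∧ R.NonTerminating r := by
  rintro ⟨r, hr, s, hs, hlen⟩
  obtain ⟨γ, hγ, -, rfl⟩ := hJ
  obtain ⟨v, hv⟩ := hr.exists_isSweepRay
  have := Sweep.locallyConnectedSpace_circle
  exact hlen.ne' (mainTheorem2_general hγ hv hs)
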